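/- Let $\mathcal C$ be an exact category, i.e. a finitely complete regular category in which every internal equivalence relation is effective (is the kernel pair of some morphism), and suppose that $\mathcal C$ is a Goursat category: $R\circ S\circ R=S\circ R\circ S$ for all equivalence relations $R,S$ on the same object, where $\circ$ is relational composition in $\mathcal C$. Let $\mathcal L$ be a Birkhoff subcategory of $\mathcal C$, i.e. a full replete reflective subcategory such that every component $\eta_A\colon A\to\lambda(A)$ of the unit of the reflection is a regular epimorphism, and such that for every regular epimorphism $f\colon A\to B$ in $\mathcal C$ with $A\in\mathcal L$ one has $B\in\mathcal L$. For an equivalence relation $S$ on an object $X$, with quotient $q\colon X\to X/S$ (the coequalizer of the two projections of $S$), let $\overline S=q^{-1}(R[\eta_{X/S}])$ be the inverse image along $q$ of the kernel pair of $\eta_{X/S}$ (equivalently, the kernel pair of $\eta_{X/S}\circ q$). Let $\Delta_X$ be the discrete (diagonal) equivalence relation on $X$. Then, for every object $X$ of $\mathcal C$ and every equivalence relation $S$ on $X$, $\overline S$ is the join of $\overline{\Delta_X}$ and $S$ in the partially ordered set of equivalence relations on $X$ (in particular this join exists), and $$\overline S=\overline{\Delta_X}\vee S=\overline{\Delta_X}\circ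 S\circ\overline{\Delta_X}=S\circ\overline{\Delta_X}\circ S .$$ Consequently the closure of the discrete relation determines all closures: if $\mathcal L'$ is another Birkhoff subcategory of $\mathcal C$ for which the closure of $\Delta_X$ is the same as for $\mathcal L$, then the closures of every equivalence relation $S$ on $X$ with respect to $\mathcal L$ and $\mathcal L'$ coincide. -/

import Mathlib

open CategoryTheory CategoryTheory.Limits

universe v u

noncomputable section

namespace GoursatClosure

/-- A (Barr-)exact category: a finitely complete regular category in which every internal
equivalence relation is effective, i.e. is the kernel pair of some morphism. -/
class BarrExact (C : Type u) [Category.{v} C] : Prop extends Regular C where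
  effective : ∀ {R X : C} (p₁ p₂ : R ⟶ X), IsEquivalenceRelation p₁ p₂ →
    ∃ (Y : C) (f : X ⟶ Y), IsKernelPair f p₁ p₂

section Relations

variable {C : Type u} [Category.{v} C] [Regular C]

/-- The first projection `R ⟶ X` of a relation `R` on `X`, given as a subobject of `X ⨯ X`. -/
abbrev p₁ {X : C} (R : Subobject (X ⨯ X)) : (R : C) ⟶ X := R.arrow ≫ prod.fst

/-- The second projection `R ⟶ X` of a relation `R` on `X`, given as a subobject of `X ⨯ X`. -/
abbrev p₂ {X : C} (R : Subobject (X ⨯ X)) : (R : C) ⟶ X := R.arrow ≫ prod.snd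

/-- The relational composite of two relations on `X`: the regular image in `X ⨯ X` of the
pullback of the second projection of `R` along the first projection of `S`. On elements,
`x (comp R S) z` iff `x R y` and `y S z` for some `y`. -/
def comp {X : C} (R S : Subobject (X ⨯ X)) : Subobject (X ⨯ X) :=
  imageSubobject
    (prod.lift (pullback.fst (p₂ R) (p₁ S) ≫ p₁ R) (pullback.snd (p₂ R) (p₁ S) ≫ p₂ S))

/-- A relation is an internal equivalence relation iff it induces an equivalence relation on
generalized elements. -/
theorem isEquivalenceRelation_iff {X : C} (R : Subobject (X ⨯ X)) :
    IsEquivalenceRelation (p₁ R) (p₂ R) ↔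
      ∀ T : C, Equivalence (fun a b : T ⟶ X => R.Factors (prod.lift a b)) := by
  constructor
  · rintro ⟨⟨e⟩⟩ T
    refine ⟨fun a => ?_, fun {a b} h => ?_, fun {a b c} h h' => ?_⟩
    · rw [Subobject.factors_iff]
      refine ⟨a ≫ e.r, ?_⟩
      change (a ≫ e.r) ≫ R.arrow = _
      have h₁ := e.reflexivity₁
      have h₂ := e.reflexivity₂
      apply Limits.prod.hom_ext
      · simp only [Category.assoc, h₁, prod.lift_fst, Category.comp_id]
      · simp only [Category.assoc, h₂, prod.lift_snd, Category.comp_id]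
    · rw [Subobject.factors_iff]
      refine ⟨R.factorThru _ h ≫ e.s, ?_⟩
      change (_ ≫ e.s) ≫ R.arrow = _
      have h₁ := e.symmetry₁
      have h₂ := e.symmetry₂
      apply Limits.prod.hom_ext
      · simp only [Category.assoc, h₁, Subobject.factorThru_arrow_assoc, prod.lift_fst,
          prod.lift_snd]
      · simp only [Category.assoc, h₂, Subobject.factorThru_arrow_assoc, prod.lift_fst,
          prod.lift_snd]
    · rw [Subobject.factors_iff]
      refine ⟨PullbackCone.IsLimit.lift e.isLimit (R.factorThru _ h) (R.factorThru _ h')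
        (by simp [p₁, p₂, prod.lift_fst, prod.lift_snd]) ≫ e.t, ?_⟩
      change (_ ≫ e.t) ≫ R.arrow = _
      have h₁ := e.transitivity₁
      have h₂ := e.transitivity₂
      apply Limits.prod.hom_ext
      · simp only [Category.assoc, h₁, PullbackCone.IsLimit.lift_fst_assoc,
          Subobject.factorThru_arrow_assoc, prod.lift_fst]
      · simp only [Category.assoc, h₂, PullbackCone.IsLimit.lift_snd_assoc,
          Subobject.factorThru_arrow_assoc, prod.lift_snd]
  · intro h
    have self : R.Factors (prod.lift (p₁ R) (p₂ R)) := by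
      have : prod.lift (p₁ R) (p₂ R) = R.arrow := by
        apply Limits.prod.hom_ext <;> simp [prod.lift_fst, prod.lift_snd]
      rw [this]
      exact (Subobject.factors_iff _ _).2 ⟨𝟙 _, Category.id_comp _⟩
    have pre : ∀ {T : C} (t : T ⟶ (R : C)), R.Factors (prod.lift (t ≫ p₁ R) (t ≫ p₂ R)) := by
      intro T t
      have : prod.lift (t ≫ p₁ R) (t ≫ p₂ R) = t ≫ prod.lift (p₁ R) (p₂ R) := by
        apply Limits.prod.hom_ext <;> simp [prod.lift_fst, prod.lift_snd]
      rw [this]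
      exact Subobject.factors_of_factors_right _ self
    have hr := (h X).refl (𝟙 X)
    have hs := (h _).symm self
    have ht := (h _).trans (pre (pullback.fst (p₂ R) (p₁ R)))
      (pullback.condition (f := p₂ R) (g := p₁ R) ▸ pre (pullback.snd (p₂ R) (p₁ R)))
    refine ⟨⟨⟨⟨⟨fun _ f g h₁ h₂ => ?_⟩, R.factorThru _ hr, ?_, ?_⟩, R.factorThru _ hs, ?_, ?_,
      PullbackCone.mk _ _ pullback.condition, pullbackIsPullback (p₂ R) (p₁ R),
      R.factorThru _ ht, ?_, ?_⟩⟩⟩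
    · have : f ≫ R.arrow = g ≫ R.arrow := by
        apply Limits.prod.hom_ext
        · simpa using h₁
        · simpa using h₂
      exact (cancel_mono R.arrow).1 this
    · simp [p₁, prod.lift_fst]
    · simp [p₂, prod.lift_snd]
    · simp [p₁, p₂, prod.lift_fst]
    · simp [p₁, p₂, prod.lift_snd]
    · exact (Subobject.factorThru_arrow_assoc _ _ _ _).trans (prod.lift_fst _ _)
    · exact (Subobject.factorThru_arrow_assoc _ _ _ _).trans (prod.lift_snd _ _)

/-- An (internal) equivalence relation on `X`, as a subobject of `X ⨯ X`. -/
@[ext]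
structure EquivRel (X : C) where
  rel : Subobject (X ⨯ X)
  isEquiv : IsEquivalenceRelation (p₁ rel) (p₂ rel)

/-- Equivalence relations on `X` are ordered by inclusion of subobjects of `X ⨯ X`. -/
instance (X : C) : PartialOrder (EquivRel X) :=
  PartialOrder.lift EquivRel.rel (fun _ _ h => EquivRel.ext h)

/-- The discrete equivalence relation on `X`: the diagonal `X ⟶ X ⨯ X`. -/
def EquivRel.discrete (X : C) : EquivRel X where
  rel := Subobject.mk (diag X)
  isEquiv := by
    rw [isEquivalenceRelation_iff]
    have key : ∀ {T : C} (a b : T ⟶ X),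
        (Subobject.mk (diag X)).Factors (prod.lift a b) ↔ a = b := by
      intro T a b
      rw [Subobject.mk_factors_iff]
      constructor
      · rintro ⟨(g : T ⟶ X), (hg : g ≫ diag X = _)⟩
        have h₁ := congrArg (· ≫ prod.fst) hg
        have h₂ := congrArg (· ≫ prod.snd) hg
        simp only [Category.assoc, diag, prod.lift_fst, prod.lift_snd, Category.comp_id] at h₁ h₂
        exact h₁.symm.trans h₂
      · rintro rfl
        refine ⟨a, ?_⟩
        change a ≫ diag X = _
        apply Limits.prod.hom_ext <;> simp [prod.lift_fst, prod.lift_snd]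
    intro T
    simp only [key]
    exact eq_equivalence

instance mono_kernelPair {X Y : C} (f : X ⟶ Y) :
    Mono (prod.lift (pullback.fst f f) (pullback.snd f f)) where
  right_cancellation g h w := by
    have h₁ := congrArg (· ≫ prod.fst) w
    have h₂ := congrArg (· ≫ prod.snd) w
    simp [prod.lift_fst, prod.lift_snd] at h₁ h₂
    exact pullback.hom_ext h₁ h₂

theorem kernelPair_factors_iff {X Y : C} (f : X ⟶ Y) {T : C} (a b : T ⟶ X) :
    (Subobject.mk (prod.lift (pullback.fst f f) (pullback.snd f f))).Factors (prod.lift a b) ↔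
      a ≫ f = b ≫ f := by
  rw [Subobject.mk_factors_iff]
  constructor
  · rintro ⟨(g : T ⟶ pullback f f), (hg : g ≫ prod.lift _ _ = _)⟩
    have h₁ := congrArg (· ≫ prod.fst) hg
    have h₂ := congrArg (· ≫ prod.snd) hg
    simp only [Category.assoc, prod.lift_fst, prod.lift_snd] at h₁ h₂
    rw [← h₁, ← h₂, Category.assoc, Category.assoc, pullback.condition]
  · intro h
    refine ⟨pullback.lift a b h, ?_⟩
    change pullback.lift a b h ≫ prod.lift _ _ = _
    apply Limits.prod.hom_ext <;>
      simp [prod.lift_fst, prod.lift_snd, pullback.lift_fst, pullback.lift_snd]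

/-- The kernel pair of `f : X ⟶ Y`, as an equivalence relation on `X`. -/
def EquivRel.kernelPair {X Y : C} (f : X ⟶ Y) : EquivRel X where
  rel := Subobject.mk (prod.lift (pullback.fst f f) (pullback.snd f f))
  isEquiv := by
    rw [isEquivalenceRelation_iff]
    intro T
    simp only [kernelPair_factors_iff]
    exact ⟨fun _ => rfl, fun h => h.symm, fun h h' => h.trans h'⟩

theorem inverseImage_factors_iff {X Y : C} (f : Y ⟶ X) (R : Subobject (X ⨯ X)) {T : C}
    (a b : T ⟶ Y) :
    ((Subobject.pullback (prod.map f f)).obj R).Factors (prod.lift a b) ↔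
      R.Factors (prod.lift (a ≫ f) (b ≫ f)) := by
  rw [pullback_factors_iff, prod.lift_map]

/-- The inverse image of an equivalence relation on `X` along `f : Y ⟶ X`: the pullback of
the subobject of `X ⨯ X` along `f × f`. -/
def EquivRel.inverseImage {X Y : C} (f : Y ⟶ X) (S : EquivRel X) : EquivRel Y where
  rel := (Subobject.pullback (prod.map f f)).obj S.rel
  isEquiv := by
    rw [isEquivalenceRelation_iff]
    intro T
    have h := (isEquivalenceRelation_iff S.rel).1 S.isEquiv T
    simp only [inverseImage_factors_iff]
    exact ⟨fun _ => h.refl _, fun w => h.symm w, fun w w' => h.trans w w'⟩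

end Relations

/-- An exact category is a Goursat category when `R ∘ S ∘ R = S ∘ R ∘ S` for all equivalence
relations `R`, `S` on a same object. -/
def IsGoursat (C : Type u) [Category.{v} C] [BarrExact C] : Prop :=
  ∀ (X : C) (R S : EquivRel X),
    comp (comp R.rel S.rel) R.rel = comp (comp S.rel R.rel) S.rel

/-- A Birkhoff subcategory of an exact category `C`: a full replete reflective subcategory, given
by the property `L` of its objects, such that the components of the unit of the reflection are
regular epimorphisms, and which is closed under regular quotients in `C`. -/
structure IsBirkhoff {C : Type u} [Category.{v} C] [BarrExact C] (L : ObjectProperty C)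
    [Reflective L.ι] : Prop where
  replete : L.IsClosedUnderIsomorphisms
  unit_regularEpi : ∀ X : C, IsRegularEpi ((reflectorAdjunction L.ι).unit.app X)
  closed_quotients : ∀ {X Y : C} (f : X ⟶ Y), IsRegularEpi f → L X → L Y

section Closure

variable {C : Type u} [Category.{v} C] [BarrExact C]

instance EquivRel.hasCoequalizer {X : C} (S : EquivRel X) :
    HasCoequalizer (p₁ S.rel) (p₂ S.rel) := by
  obtain ⟨Y, f, hf⟩ := BarrExact.effective _ _ S.isEquiv
  exact Regular.hasCoequalizer_of_isKernelPair hf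

/-- The quotient `X / S`: the coequalizer of the two projections of `S`. -/
def EquivRel.quotient {X : C} (S : EquivRel X) : C := coequalizer (p₁ S.rel) (p₂ S.rel)

/-- The canonical quotient morphism `q : X ⟶ X / S`. -/
def EquivRel.quotientMap {X : C} (S : EquivRel X) : X ⟶ S.quotient :=
  coequalizer.π (p₁ S.rel) (p₂ S.rel)

/-- The closure of `S` associated with the reflective subcategory `L`: the inverse image, along
the quotient `q : X ⟶ X / S`, of the kernel pair of the unit `η : X / S ⟶ λ (X / S)`. -/
def closure (L : ObjectProperty C) [Reflective L.ι] {X : C} (S : EquivRel X) : EquivRel X :=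
  EquivRel.inverseImage S.quotientMap
    (EquivRel.kernelPair ((reflectorAdjunction L.ι).unit.app S.quotient))

end Closure

end GoursatClosure

end

/-! Write D for the closure of the discrete relation; it is the kernel pair of the unit at X. If an
equivalence relation U contains D and S, then X ⟶ X/U factors through the unit of X, so X/U is a
regular quotient of an object of L and lies in L. Hence X/S ⟶ X/U factors through the unit of X/S,
and U contains the closure of S (`IsBirkhoff.closure_le`). The closure is therefore the join of D
and S. The Goursat identity makes D ∘ S ∘ D transitive, so this composite is the same join, and
uniqueness of least upper bounds gives the formulas. -/

namespace GoursatClosure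

/-! ### Calculus of relations on generalized elements. -/

section Relations

variable {C : Type u} [Category.{v} C] [Regular C]

/-- The generalized elements `a` and `b` of `X` are related by `R`. -/
def Related {X T : C} (R : Subobject (X ⨯ X)) (a b : T ⟶ X) : Prop :=
  R.Factors (prod.lift a b)

theorem Related.precomp {X T T' : C} {R : Subobject (X ⨯ X)} {a b : T ⟶ X}
    (h : Related R a b) (e : T' ⟶ T) : Related R (e ≫ a) (e ≫ b) := by
  unfold Related
  rw [← prod.comp_lift]
  exact Subobject.factors_of_factors_right e h

omit [Regular C] in
/-- Subobjects are local for strong epimorphisms. -/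
theorem factors_of_strongEpi_comp {A T T' : C} {P : Subobject A} {f : T ⟶ A} (e : T' ⟶ T)
    [StrongEpi e] (h : P.Factors (e ≫ f)) : P.Factors f := by
  have sq : CommSq (P.factorThru _ h) e P.arrow f := ⟨P.factorThru_arrow _ h⟩
  exact (Subobject.factors_iff _ _).2 ⟨sq.lift, sq.fac_right⟩

theorem Related.of_strongEpi {X T T' : C} {R : Subobject (X ⨯ X)} {a b : T ⟶ X} (e : T' ⟶ T)
    [StrongEpi e] (h : Related R (e ≫ a) (e ≫ b)) : Related R a b := by
  unfold Related at h
  rw [← prod.comp_lift] at h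
  exact factors_of_strongEpi_comp e h

theorem related_projections {X : C} (R : Subobject (X ⨯ X)) : Related R (p₁ R) (p₂ R) := by
  have : prod.lift (p₁ R) (p₂ R) = R.arrow := by
    apply Limits.prod.hom_ext <;> simp [prod.lift_fst, prod.lift_snd]
  unfold Related
  rw [this]
  exact Subobject.factors_self R

theorem Related.exists_fac {X T : C} {R : Subobject (X ⨯ X)} {a b : T ⟶ X}
    (h : Related R a b) : ∃ t : T ⟶ (R : C), t ≫ p₁ R = a ∧ t ≫ p₂ R = b :=
  ⟨R.factorThru _ h, (Subobject.factorThru_arrow_assoc _ _ _ _).trans (prod.lift_fst _ _),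
    (Subobject.factorThru_arrow_assoc _ _ _ _).trans (prod.lift_snd _ _)⟩

/-- Yoneda: the pair of projections of R is its universal related pair, so testing on it suffices.
-/
theorem le_iff_related {X : C} {R S : Subobject (X ⨯ X)} :
    R ≤ S ↔ ∀ {T : C} (a b : T ⟶ X), Related R a b → Related S a b := by
  refine ⟨fun h _ a b hab => Subobject.factors_of_le _ h hab, fun h => ?_⟩
  have hS : Related S (p₁ R) (p₂ R) := h _ _ (related_projections R)
  obtain ⟨t, h₁, h₂⟩ := hS.exists_fac
  refine Subobject.le_of_factors ((Subobject.factors_iff _ _).2 ⟨t, ?_⟩)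
  change t ≫ S.arrow = R.arrow
  apply Limits.prod.hom_ext <;> simpa using by assumption

/-- The image of `f` consists of the generalized elements which locally lift along `f`. -/
theorem exists_cover_of_imageSubobject_factors {A B T : C} (f : A ⟶ B) {g : T ⟶ B}
    (h : (imageSubobject f).Factors g) :
    ∃ (T' : C) (e : T' ⟶ T) (k : T' ⟶ A), StrongEpi e ∧ e ≫ g = k ≫ f := by
  have : StrongEpi (factorThruImageSubobject f) := by
    unfold factorThruImageSubobject
    exact strongEpi_comp _ _
  refine ⟨pullback ((imageSubobject f).factorThru g h) (factorThruImageSubobject f),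
    pullback.fst _ _, pullback.snd _ _, inferInstance, ?_⟩
  have w := congrArg (· ≫ (imageSubobject f).arrow)
    (pullback.condition (f := (imageSubobject f).factorThru g h)
      (g := factorThruImageSubobject f))
  simpa using w

/-- A composite is a regular image, so the intermediate element exists only after passing to a cover
of T; conversely, relatedness descends along strong epimorphisms. -/
theorem related_comp_iff {X T : C} {R S : Subobject (X ⨯ X)} {a b : T ⟶ X} :
    Related (comp R S) a b ↔ ∃ (T' : C) (e : T' ⟶ T) (c : T' ⟶ X), StrongEpi e ∧
      Related R (e ≫ a) c ∧ Related S c (e ≫ b) := by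
  constructor
  · intro h
    obtain ⟨T', e, k, he, w⟩ := exists_cover_of_imageSubobject_factors _ h
    have w₁ := congrArg (· ≫ prod.fst) w
    have w₂ := congrArg (· ≫ prod.snd) w
    simp only [Category.assoc, prod.lift_fst, prod.lift_snd] at w₁ w₂
    refine ⟨T', e, (k ≫ pullback.fst (p₂ R) (p₁ S)) ≫ p₂ R, he, ?_, ?_⟩
    · have := (related_projections R).precomp (k ≫ pullback.fst (p₂ R) (p₁ S))
      rwa [w₁, ← Category.assoc k]
    · have := (related_projections S).precomp (k ≫ pullback.snd (p₂ R) (p₁ S))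
      rwa [w₂, Category.assoc k, pullback.condition, ← Category.assoc k, ← Category.assoc k]
  · rintro ⟨T', e, c, he, hR, hS⟩
    obtain ⟨r, hr₁, hr₂⟩ := hR.exists_fac
    obtain ⟨s, hs₁, hs₂⟩ := hS.exists_fac
    refine Related.of_strongEpi e ?_
    have : prod.lift (e ≫ a) (e ≫ b) = pullback.lift r s (hr₂.trans hs₁.symm) ≫
        prod.lift (pullback.fst (p₂ R) (p₁ S) ≫ p₁ R) (pullback.snd (p₂ R) (p₁ S) ≫ p₂ S) := by
      rw [prod.comp_lift, pullback.lift_fst_assoc, pullback.lift_snd_assoc, hr₁, hs₂]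
    unfold Related comp
    rw [this]
    exact imageSubobject_factors_comp_self _ _

theorem Related.comp {X T : C} {R S : Subobject (X ⨯ X)} {a b c : T ⟶ X}
    (h : Related R a b) (h' : Related S b c) : Related (GoursatClosure.comp R S) a c :=
  related_comp_iff.2 ⟨T, 𝟙 T, b, inferInstance, by simpa using h, by simpa using h'⟩

theorem Related.exists_of_comp_comp {X T : C} {R S U : Subobject (X ⨯ X)} {a b : T ⟶ X}
    (h : Related (GoursatClosure.comp (GoursatClosure.comp R S) U) a b) :
    ∃ (T' : C) (e : T' ⟶ T) (c d : T' ⟶ X), StrongEpi e ∧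
      Related R (e ≫ a) c ∧ Related S c d ∧ Related U d (e ≫ b) := by
  obtain ⟨T₁, e₁, d, he₁, hRS, hU⟩ := related_comp_iff.1 h
  obtain ⟨T₂, e₂, c, he₂, hR, hS⟩ := related_comp_iff.1 hRS
  refine ⟨T₂, e₂ ≫ e₁, c, e₂ ≫ d, strongEpi_comp _ _, ?_, hS, ?_⟩
  · simpa using hR
  · simpa using hU.precomp e₂

/-! ### Joins of equivalence relations as triple composites. -/

namespace EquivRel

variable {X T : C} (R : EquivRel X) {a b c : T ⟶ X}

theorem refl (a : T ⟶ X) : Related R.rel a a :=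
  ((isEquivalenceRelation_iff R.rel).1 R.isEquiv T).refl a

variable {R}

theorem symm (h : Related R.rel a b) : Related R.rel b a :=
  ((isEquivalenceRelation_iff R.rel).1 R.isEquiv T).symm h

theorem trans (h : Related R.rel a b) (h' : Related R.rel b c) : Related R.rel a c :=
  ((isEquivalenceRelation_iff R.rel).1 R.isEquiv T).trans h h'

theorem comp_comp_le {D S U : EquivRel X} (hD : D ≤ U) (hS : S ≤ U) :
    comp (comp D.rel S.rel) D.rel ≤ U.rel := by
  refine le_iff_related.2 fun a b h => ?_
  obtain ⟨T', e, c, d, he, h₁, h₂, h₃⟩ := h.exists_of_comp_comp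
  exact Related.of_strongEpi e (trans (trans (le_iff_related.1 hD _ _ h₁)
    (le_iff_related.1 hS _ _ h₂)) (le_iff_related.1 hD _ _ h₃))

/-- If `D ∘ S ∘ D = S ∘ D ∘ S`, then this composite is an equivalence relation. -/
noncomputable def goursatJoin (D S : EquivRel X)
    (h : comp (comp D.rel S.rel) D.rel = comp (comp S.rel D.rel) S.rel) : EquivRel X where
  rel := comp (comp D.rel S.rel) D.rel
  isEquiv := by
    rw [isEquivalenceRelation_iff]
    intro T
    refine ⟨fun a => ((D.refl a).comp (S.refl a)).comp (D.refl a), fun {a b} hab => ?_,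
      fun {a b c} hab hbc => ?_⟩
    · obtain ⟨T', e, x, y, he, h₁, h₂, h₃⟩ := Related.exists_of_comp_comp hab
      exact Related.of_strongEpi e (((symm h₃).comp (symm h₂)).comp (symm h₁))
    · obtain ⟨T₁, e₁, x, y, he₁, h₁, h₂, h₃⟩ := Related.exists_of_comp_comp hab
      obtain ⟨T₂, e₂, x', y', he₂, h₁', h₂', h₃'⟩ :=
        ((show Related _ b c from hbc).precomp e₁).exists_of_comp_comp
      -- The chain is a D x S y D b D x' S y' D c. Merging the two adjacent D steps leaves S D S
      -- from x to y', which the hypothesis turns into D S D; its outer D steps are then absorbed at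
      -- both ends.
      have hSDS : Related (comp (comp S.rel D.rel) S.rel) (e₂ ≫ x) y' :=
        ((h₂.precomp e₂).comp (trans (h₃.precomp e₂) h₁')).comp h₂'
      rw [← h] at hSDS
      obtain ⟨T₃, e₃, s, t, he₃, k₁, k₂, k₃⟩ := hSDS.exists_of_comp_comp
      refine Related.of_strongEpi e₁ (Related.of_strongEpi e₂ (Related.of_strongEpi e₃ ?_))
      exact ((trans ((h₁.precomp e₂).precomp e₃) k₁).comp k₂).comp
        (trans k₃ (h₃'.precomp e₃))

theorem isLUB_goursatJoin (D S : EquivRel X)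
    (h : comp (comp D.rel S.rel) D.rel = comp (comp S.rel D.rel) S.rel) :
    IsLUB {D, S} (goursatJoin D S h) := by
  constructor
  · rintro U (rfl | rfl)
    · exact le_iff_related.2 fun a b hab => (hab.comp (S.refl b)).comp (refl _ b)
    · exact le_iff_related.2 fun a b hab => ((D.refl a).comp hab).comp (D.refl b)
  · intro U hU
    exact comp_comp_le (hU (by simp)) (hU (by simp))

end EquivRel

end Relations

/-! ### Closures and the reflection. -/

section Closure

variable {C : Type u} [Category.{v} C] [BarrExact C]

theorem related_iff_of_isKernelPair {X Y T : C} {R : Subobject (X ⨯ X)} {f : X ⟶ Y}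
    (hf : IsKernelPair f (p₁ R) (p₂ R)) {a b : T ⟶ X} : Related R a b ↔ a ≫ f = b ≫ f := by
  constructor
  · intro h
    obtain ⟨t, rfl, rfl⟩ := h.exists_fac
    simp only [Category.assoc, hf.w]
  · intro h
    have := (related_projections R).precomp (hf.lift a b h)
    rwa [hf.lift_fst, hf.lift_snd] at this

instance EquivRel.isRegularEpi_quotientMap {X : C} (S : EquivRel X) :
    IsRegularEpi S.quotientMap :=
  inferInstanceAs (IsRegularEpi (coequalizer.π _ _))

theorem EquivRel.comp_quotientMap_eq {X T : C} {S : EquivRel X} {a b : T ⟶ X}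
    (h : Related S.rel a b) : a ≫ S.quotientMap = b ≫ S.quotientMap := by
  obtain ⟨t, rfl, rfl⟩ := h.exists_fac
  have := coequalizer.condition (p₁ S.rel) (p₂ S.rel)
  exact (Category.assoc _ _ _).trans ((congrArg (t ≫ ·) this).trans (Category.assoc _ _ _).symm)

/-- Equivalence relations in an exact category are the kernel pairs of their quotients. -/
theorem EquivRel.related_iff {X T : C} {S : EquivRel X} {a b : T ⟶ X} :
    Related S.rel a b ↔ a ≫ S.quotientMap = b ≫ S.quotientMap := by
  refine ⟨comp_quotientMap_eq, fun h => ?_⟩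
  obtain ⟨Y, f, hf⟩ := BarrExact.effective _ _ S.isEquiv
  refine (related_iff_of_isKernelPair hf).2 ?_
  -- Effectiveness gives S only as the kernel pair of some `f`; since `f` factors through the
  -- quotient, elements equal in the quotient are equal under `f`.
  obtain ⟨g, w⟩ : ∃ g : S.quotient ⟶ Y, S.quotientMap ≫ g = f :=
    ⟨coequalizer.desc f hf.w, coequalizer.π_desc f hf.w⟩
  rw [← w, ← Category.assoc, h, Category.assoc]

variable (L : ObjectProperty C) [Reflective L.ι]

/-- The unit of the reflection, with codomain written as an object of `C`. -/
abbrev unitMap (X : C) : X ⟶ ((reflector L.ι).obj X).obj :=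
  (reflectorAdjunction L.ι).unit.app X

omit [BarrExact C] in
theorem unitMap_naturality {X Y : C} (f : X ⟶ Y) :
    f ≫ unitMap L Y = unitMap L X ≫ ((reflector L.ι).map f).hom :=
  ((reflectorAdjunction L.ι).unit_naturality f).symm

omit [BarrExact C] in
theorem exists_unitMap_comp_eq {X Y : C} (hY : L Y) (f : X ⟶ Y) :
    ∃ g : ((reflector L.ι).obj X).obj ⟶ Y, unitMap L X ≫ g = f :=
  ⟨(((reflectorAdjunction L.ι).homEquiv X ⟨Y, hY⟩).symm f).hom,
    ((reflectorAdjunction L.ι).homEquiv_unit ..).symm.trans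
      (((reflectorAdjunction L.ι).homEquiv X ⟨Y, hY⟩).apply_symm_apply f)⟩

theorem related_closure_iff {X T : C} {S : EquivRel X} {a b : T ⟶ X} :
    Related (closure L S).rel a b ↔
      (a ≫ S.quotientMap) ≫ unitMap L S.quotient = (b ≫ S.quotientMap) ≫ unitMap L S.quotient :=
  (inverseImage_factors_iff _ _ a b).trans (kernelPair_factors_iff _ _ _)

theorem le_closure {X : C} (S : EquivRel X) : S ≤ closure L S := by
  refine le_iff_related.2 fun a b h => (related_closure_iff L).2 ?_
  rw [EquivRel.related_iff.1 h]

instance EquivRel.isIso_quotientMap_discrete (X : C) :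
    IsIso (EquivRel.discrete X).quotientMap := by
  have h : p₁ (EquivRel.discrete X).rel = p₂ (EquivRel.discrete X).rel := by
    change (Subobject.mk (diag X)).arrow ≫ prod.fst = (Subobject.mk (diag X)).arrow ≫ prod.snd
    rw [← cancel_epi (Subobject.underlyingIso (diag X)).inv]
    simp [prod.lift_fst, prod.lift_snd, diag]
  exact coequalizer.π_of_eq h

/-- The closure of the discrete relation is the kernel pair of the unit. -/
theorem related_closure_discrete_iff {X T : C} {a b : T ⟶ X} :
    Related (closure L (EquivRel.discrete X)).rel a b ↔ a ≫ unitMap L X = b ≫ unitMap L X := by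
  rw [related_closure_iff, Category.assoc, Category.assoc, unitMap_naturality,
    ← Category.assoc, ← Category.assoc]
  -- The reflector sends the isomorphism X ⟶ X/Δ to an isomorphism, which can be cancelled.
  exact cancel_mono _

/-- By naturality, the map whose kernel pair is the closure of S factors through the unit of X. -/
theorem closure_discrete_le {X : C} (S : EquivRel X) :
    closure L (EquivRel.discrete X) ≤ closure L S := by
  refine le_iff_related.2 fun a b h => (related_closure_iff L).2 ?_
  rw [Category.assoc, Category.assoc, unitMap_naturality, ← Category.assoc, ← Category.assoc,
    (related_closure_discrete_iff L).1 h]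

variable {L}

omit [BarrExact C] in
/-- Morphisms coequalizing the kernel pair of a regular epimorphism factor through it. -/
theorem exists_comp_eq_of_isRegularEpi {X Y Z : C} (f : X ⟶ Y) [IsRegularEpi f] (g : X ⟶ Z)
    (h : ∀ {T : C} (a b : T ⟶ X), a ≫ f = b ≫ f → a ≫ g = b ≫ g) : ∃ k : Y ⟶ Z, f ≫ k = g :=
  ⟨IsRegularEpi.desc f g (h _ _ (IsRegularEpi.w f)), IsRegularEpi.fac f g _⟩

/-- The closure of `S` lies below every equivalence relation containing both `S` and the closure
of the discrete relation. -/
theorem IsBirkhoff.closure_le (hL : IsBirkhoff L) {X : C} {S U : EquivRel X}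
    (hD : closure L (EquivRel.discrete X) ≤ U) (hS : S ≤ U) : closure L S ≤ U := by
  have := hL.unit_regularEpi X
  obtain ⟨k, hk⟩ := exists_comp_eq_of_isRegularEpi (unitMap L X) U.quotientMap fun a b h =>
    EquivRel.related_iff.1 (le_iff_related.1 hD a b ((related_closure_discrete_iff L).2 h))
  -- As second factor of a strong epimorphism, `k` is strong, hence regular in a regular category,
  -- so closure under quotients applies to it.
  have hk' : StrongEpi (unitMap L X ≫ k) := by rw [hk]; infer_instance
  have : StrongEpi k := strongEpi_of_strongEpi (unitMap L X) k
  have hU : L U.quotient :=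
    hL.closed_quotients k inferInstance ((reflector L.ι).obj X).property
  obtain ⟨g, hg⟩ := exists_comp_eq_of_isRegularEpi S.quotientMap U.quotientMap fun a b h =>
    EquivRel.related_iff.1 (le_iff_related.1 hS a b (EquivRel.related_iff.2 h))
  obtain ⟨g', rfl⟩ := exists_unitMap_comp_eq L hU g
  refine le_iff_related.2 fun a b h => EquivRel.related_iff.2 ?_
  simpa [hg] using congrArg (· ≫ g') ((related_closure_iff L).1 h)

theorem IsBirkhoff.isLUB_closure (hL : IsBirkhoff L) {X : C} (S : EquivRel X) :
    IsLUB {closure L (EquivRel.discrete X), S} (closure L S) := by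
  constructor
  · rintro U (rfl | rfl)
    · exact closure_discrete_le L S
    · exact le_closure L U
  · intro U hU
    exact hL.closure_le (hU (by simp)) (hU (by simp))

theorem IsBirkhoff.closure_rel_eq (hL : IsBirkhoff L) (hC : IsGoursat C) {X : C}
    (S : EquivRel X) :
    (closure L S).rel = comp (comp (closure L (EquivRel.discrete X)).rel S.rel)
      (closure L (EquivRel.discrete X)).rel :=
  -- Both sides are least upper bounds of the same pair.
  congrArg EquivRel.rel
    ((hL.isLUB_closure S).unique (EquivRel.isLUB_goursatJoin _ S (hC X _ _)))

end Closure

end GoursatClosure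

theorem mainTheorem3 {C : Type u} [Category.{v} C] [GoursatClosure.BarrExact C]
    (hC : GoursatClosure.IsGoursat C)
    (L : ObjectProperty C) [Reflective L.ι] (hL : GoursatClosure.IsBirkhoff L) (X : C) :
    (∀ S : GoursatClosure.EquivRel X,
      IsLUB {GoursatClosure.closure L (GoursatClosure.EquivRel.discrete X), S}
          (GoursatClosure.closure L S) ∧
        (GoursatClosure.closure L S).rel =
          GoursatClosure.comp
            (GoursatClosure.comp
              (GoursatClosure.closure L (GoursatClosure.EquivRel.discrete X)).rel S.rel)
            (GoursatClosure.closure L (GoursatClosure.EquivRel.discrete X)).rel ∧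
        (GoursatClosure.closure L S).rel =
          GoursatClosure.comp
            (GoursatClosure.comp S.rel
              (GoursatClosure.closure L (GoursatClosure.EquivRel.discrete X)).rel)
            S.rel) ∧
    (∀ (L' : ObjectProperty C) [Reflective L'.ι], GoursatClosure.IsBirkhoff L' →
      GoursatClosure.closure L' (GoursatClosure.EquivRel.discrete X) =
        GoursatClosure.closure L (GoursatClosure.EquivRel.discrete X) →
      ∀ S : GoursatClosure.EquivRel X,
        GoursatClosure.closure L' S = GoursatClosure.closure L S) := by
  exact ⟨fun S => ⟨hL.isLUB_closure S, hL.closure_rel_eq hC S,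
      (hL.closure_rel_eq hC S).trans (hC X _ _)⟩,
    fun L' _ hL' h S => (hL'.isLUB_closure S).unique (h ▸ hL.isLUB_closure S)⟩
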